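/- Let $G=(V,E)$ be a finite acyclic directed multigraph (parallel channels allowed, every channel of unit capacity) with a single source node $s$ without incoming channels and a set $T\subseteq V\setminus\{s\}$ of sink nodes without outgoing channels. For $t\in T$ let $C_t$ be the minimum cut capacity between $s$ and $t$. Let $w\ge 1$ be the information rate, assume $w\le C_t$ for all $t\in T$, and put $\delta_t=C_t-w$. Let $\mathcal F$ be a field. A linear network (error correction) code of rate $w$ over $\mathcal F$ is a choice of local encoding coefficients $k_{d,e}\in\mathcal F$ for all $e\in E$ and $d\in In(tail(e))$, where $In(i)$ is the set of incoming channels of $i$ and $In(s)=\{d_1',\dots,d_w'\}$ consists of $w$ imaginary message channels. Its extended global encoding kernels $\tilde f_e\in\mathcal F^{In(s)\cup E}$ (column vectors) are determined by $\tilde f_{d_i'}=1_{d_i'}$ and $$\tilde f_e=\sum_{d\in In(tail(e))}k_{d,e}\tilde f_d+1_e\qquad(e\in E),$$ where $1_d$ is the indicator vector of $d$. For a sink $t$ let $\tilde F_t=(\tilde f_e: e\in In(t))$. The message space is $\Phi(t)=\{(X,0)\tilde F_t: X\in\mathcal F^w\}$, and the error space of an error pattern $\rho\subseteq E$ is $\Delta(t,\rho)=\{(0,Z)\tilde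 F_t: Z\in\mathcal F^{E},\ Z_e=0 \text{ for } e\notin\rho\}$. An error pattern $\rho_1$ is dominated by $\rho_2$ with respect to $t$, written $\rho_1\prec_t\rho_2$, if $\Delta(t,\rho_1)\subseteq\Delta(t,\rho_2)$ for every linear network code over $\mathcal F$. Let $rank_t(\rho)=\min\{|\rho'|:\rho\prec_t\rho'\}$ and $R_t(\delta_t)=\{\rho\subseteq E: |\rho|=rank_t(\rho)=\delta_t\}$. A code is regular if $\dim\Phi(t)=w$ for all $t\in T$. The minimum distance of a regular code at $t$ is $d_{\min}^{(t)}=\min\{rank_t(\rho):\dim(\Delta(t,\rho)\cap\Phi(t))>0\}$. Theorem. If $|\mathcal F|\ge\sum_{t\in T}|R_t(\delta_t)|$, then there exists a linear network error correction MDS code of rate $w$ over $\mathcal F$, i.e. a regular code such that $d_{\min}^{(t)}=\delta_t+1$ for every $t\in T$. -/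

import Mathlib

namespace NEC

/-- A single-source multicast network: an acyclic directed multigraph with node type `V` and
channel type `E` (all channels have unit capacity), a source node without incoming channels, and
a set of sink nodes, different from the source, without outgoing channels. -/
structure Network (V E : Type*) where
  tail : E → V
  head : E → V
  source : V
  sinks : Finset V
  acyclic : ∀ v, ¬ Relation.TransGen (fun i j => ∃ e, tail e = i ∧ head e = j) v v
  source_notMem_sinks : source ∉ sinks
  head_ne_source : ∀ e, head e ≠ source
  tail_notMem_sinks : ∀ e, tail e ∉ sinks

namespace Network

variable {V E : Type*} (N : Network V E)

/-- The sequence of channels `p` is a path from node `i` to node `j`. -/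
def IsPath (i j : V) (p : List E) : Prop :=
  p.head?.map N.tail = some i ∧ p.getLast?.map N.head = some j ∧
    p.IsChain (fun d e => N.head d = N.tail e)

/-- Removing the channels of `C` disconnects `i` from `j`: every path from `i` to `j` uses a
channel of `C`. -/
def IsCut (i j : V) (C : Finset E) : Prop :=
  ∀ p : List E, N.IsPath i j p → ∃ e ∈ p, e ∈ C

/-- The minimum cut capacity between two (distinct) nodes. -/
noncomputable def minCut (i j : V) : ℕ :=
  sInf {n | ∃ C : Finset E, N.IsCut i j C ∧ C.card = n}

/-- The redundancy `C_t - w` of the sink `t` at information rate `w`. It is used only when `w` is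
at most the minimum cut capacity `C_t` between the source and `t`. -/
noncomputable def redundancy (w : ℕ) (t : V) : ℕ :=
  N.minCut N.source t - w

theorem wellFounded_adj [Finite E] : WellFounded (fun d e : E => N.head d = N.tail e) := by
  have hlift : ∀ d e, Relation.TransGen (fun d e : E => N.head d = N.tail e) d e →
      Relation.TransGen (fun i j => ∃ e, N.tail e = i ∧ N.head e = j) (N.tail d) (N.tail e) := by
    intro d e h
    induction h with
    | single h => exact Relation.TransGen.single ⟨_, rfl, h⟩
    | tail _ h ih => exact ih.tail ⟨_, rfl, h⟩
  have : Std.Irrefl (Relation.TransGen (fun d e : E => N.head d = N.tail e)) :=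
    ⟨fun e h => N.acyclic (N.tail e) (hlift e e h)⟩
  have hwf : WellFounded (Relation.TransGen (fun d e : E => N.head d = N.tail e)) :=
    Finite.wellFounded_of_trans_of_irrefl _
  exact Subrelation.wf (r := Relation.TransGen (fun d e : E => N.head d = N.tail e))
    (fun {_ _} h => Relation.TransGen.single h) hwf

variable [Fintype E]

open Classical in
/-- The incoming channels of the node `i`. `Sum.inr e` is the channel `e`, and `Sum.inl j` is the
`j`-th of the `w` imaginary message channels, all of which enter the source. -/
noncomputable def inChannels (w : ℕ) (i : V) : Finset (Fin w ⊕ E) :=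
  Finset.univ.filter (Sum.elim (fun _ => i = N.source) (fun e => N.head e = i))

/-- A linear network code over `F` of information rate `w`, given by its local encoding
coefficients `k d e` for adjacent pairs of channels (`0` for the other pairs). -/
structure LinearCode (F : Type*) [Field F] (w : ℕ) where
  k : Fin w ⊕ E → E → F
  k_eq_zero : ∀ d e, d ∉ N.inChannels w (N.tail e) → k d e = 0

namespace LinearCode

variable {N} {F : Type*} [Field F] {w : ℕ} (c : N.LinearCode F w)

open Classical in
/-- The extended global encoding kernel of a channel, defined by recursion along the network:
`f_e` is the sum of `k d e • f_d` over the incoming channels `d` of the tail of `e`, plus the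
indicator of `e`, where the kernel of an imaginary message channel is its own indicator. -/
noncomputable def kernel : E → (Fin w ⊕ E → F) :=
  N.wellFounded_adj.fix fun e f =>
    (∑ d ∈ (N.inChannels w (N.tail e)).attach,
      c.k d.1 e • (match d with
        | ⟨Sum.inl j, _⟩ => Pi.single (Sum.inl j) 1
        | ⟨Sum.inr d, h⟩ => f d (by simpa [inChannels] using h)))
    + Pi.single (Sum.inr e) 1

open Classical in
/-- The recursive formula for the extended global encoding kernels. -/
theorem kernel_eq (e : E) : c.kernel e =
    (∑ d ∈ N.inChannels w (N.tail e),
      c.k d e • Sum.elim (fun j => Pi.single (Sum.inl j) 1) c.kernel d)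
    + Pi.single (Sum.inr e) 1 := by
  unfold kernel
  rw [WellFounded.fix_eq]
  congr 1
  rw [← Finset.sum_attach (N.inChannels w (N.tail e))]
  refine Finset.sum_congr rfl fun d _ => ?_
  rcases d with ⟨d | d, h⟩ <;> rfl

/-- The decoding matrix at the node `t`: its columns are the kernels of the incoming channels. -/
noncomputable def decodingMatrix (t : V) : Matrix (Fin w ⊕ E) {e : E // N.head e = t} F :=
  Matrix.of fun d e => c.kernel e.1 d

/-- The error space of the error pattern `ρ`: all `(0, Z) * (decoding matrix)`, where the error
message vector `Z` vanishes outside `ρ`. -/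
noncomputable def errorSpace (t : V) (ρ : Finset E) : Submodule F ({e : E // N.head e = t} → F) where
  carrier := {v | ∃ Z : E → F, (∀ e, e ∉ ρ → Z e = 0) ∧
    v = Matrix.vecMul (Sum.elim (0 : Fin w → F) Z) (c.decodingMatrix t)}
  zero_mem' := ⟨0, fun _ _ => rfl, by
    rw [show Sum.elim (0 : Fin w → F) (0 : E → F) = 0 by ext (x | x) <;> rfl, Matrix.zero_vecMul]⟩
  add_mem' := by
    rintro _ _ ⟨Z, hZ, rfl⟩ ⟨Z', hZ', rfl⟩
    refine ⟨Z + Z', fun e he => by simp [hZ e he, hZ' e he], ?_⟩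
    rw [← Matrix.add_vecMul]
    congr 1
    ext (x | x) <;> simp
  smul_mem' := by
    rintro a _ ⟨Z, hZ, rfl⟩
    refine ⟨a • Z, fun e he => by simp [hZ e he], ?_⟩
    rw [← Matrix.smul_vecMul]
    congr 1
    ext (x | x) <;> simp

/-- The message space: all `(X, 0) * (decoding matrix)`. -/
noncomputable def messageSpace (t : V) : Submodule F ({e : E // N.head e = t} → F) where
  carrier := {v | ∃ X : Fin w → F,
    v = Matrix.vecMul (Sum.elim X (0 : E → F)) (c.decodingMatrix t)}
  zero_mem' := ⟨0, by
    rw [show Sum.elim (0 : Fin w → F) (0 : E → F) = 0 by ext (x | x) <;> rfl, Matrix.zero_vecMul]⟩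
  add_mem' := by
    rintro _ _ ⟨X, rfl⟩ ⟨X', rfl⟩
    refine ⟨X + X', ?_⟩
    rw [← Matrix.add_vecMul]
    congr 1
    ext (x | x) <;> simp
  smul_mem' := by
    rintro a _ ⟨X, rfl⟩
    refine ⟨a • X, ?_⟩
    rw [← Matrix.smul_vecMul]
    congr 1
    ext (x | x) <;> simp

end LinearCode

/-- The error pattern `ρ₁` is dominated by `ρ₂` with respect to `t`: the error space of `ρ₁` is
contained in that of `ρ₂` for every linear network code over `F`. -/
def Dominated (F : Type*) [Field F] (t : V) (ρ₁ ρ₂ : Finset E) : Prop :=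
  ∀ (w : ℕ) (c : N.LinearCode F w), c.errorSpace t ρ₁ ≤ c.errorSpace t ρ₂

/-- The rank of an error pattern: the least size of a pattern that dominates it. -/
noncomputable def rank (F : Type*) [Field F] (t : V) (ρ : Finset E) : ℕ :=
  sInf {n | ∃ ρ' : Finset E, N.Dominated F t ρ ρ' ∧ ρ'.card = n}

open Classical in
/-- `R_t(β)`: the error patterns whose size and rank with respect to `t` both equal `β`. -/
noncomputable def fullRankPatterns (F : Type*) [Field F] (t : V) (β : ℕ) : Finset (Finset E) :=
  Finset.univ.filter fun ρ => ρ.card = β ∧ N.rank F t ρ = β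

namespace LinearCode

variable {N} {F : Type*} [Field F] {w : ℕ} (c : N.LinearCode F w)

/-- A code is regular if the message space at every sink has dimension `w`. -/
def IsRegular : Prop :=
  ∀ t ∈ N.sinks, Module.finrank F (c.messageSpace t) = w

/-- The minimum distance of a regular code at `t`: the least rank of an error pattern whose error
space meets the message space nontrivially. -/
noncomputable def minDistance (t : V) : ℕ :=
  sInf {n | ∃ ρ : Finset E,
    0 < Module.finrank F ↥(c.errorSpace t ρ ⊓ c.messageSpace t) ∧ N.rank F t ρ = n}

/-- A network error correction MDS code: a regular code that attains the refined Singleton bound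
`d_min ≤ δ_t + 1` at every sink. -/
def IsMDS : Prop :=
  c.IsRegular ∧ ∀ t ∈ N.sinks, c.minDistance t = N.redundancy w t + 1

end LinearCode

end Network

end NEC

/-!
Domination of error patterns is governed by cuts: `ρ` is dominated by `C` with respect to `t` if and
only if `C` separates `ρ` from `t` (`Separates.dominated`, `Dominated.separates`), so the rank of a
pattern is a minimum cut, independently of the field. Submodularity of cuts then shows that every
pattern whose size equals its rank and is at most `C_t` can be enlarged within such patterns up to
size `C_t` (`exists_superset_full_rank`). Hence each pattern of rank at most `δ_t` is dominated by a
member of `R_t(δ_t)`, and a code is MDS as soon as, for each `t` and each `ρ ∈ R_t(δ_t)`, a message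
and an error on `ρ` that cancel at `t` have zero message; the Singleton bound
`LinearCode.exists_errorSpace_inf_messageSpace_ne_bot` gives the opposite inequality.

For `ρ ∈ R_t(δ_t)`, the `w` message channels and the `δ_t` channels of `ρ` can be joined to `t` by
`w + δ_t` disjoint paths. In an acyclic network this form of Menger's theorem is a case of Hall's
marriage theorem (`exists_isLinking`). The code is built channel by channel, upstream first, while
for each pair `(t, ρ)` the kernels on the current frontier of its paths, projected to the
coordinates of the message channels and of `ρ`, are kept linearly independent. At each channel a
pair excludes only a proper subspace of coefficients (`HasFrontier.exists_submodule`). A channel of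
`ρ` itself imposes nothing, because of its own error coordinate; so the excluded sets are linear,
not merely affine, subspaces, and a field with at least as many elements as there are pairs suffices
(`exists_forall_notMem_of_card_le`). In the end the kernels entering `t` span all these coordinates
(`HasFrontier.eq_zero_of_signal_eq_zero`).
-/

namespace NEC

namespace Network

variable {V E : Type*} {N : Network V E}

/-! ### Signals carried by the channels -/

section Signals

variable [Fintype E]

@[simp]
theorem inl_mem_inChannels {w : ℕ} {j : Fin w} {i : V} :
    (Sum.inl j : Fin w ⊕ E) ∈ N.inChannels w i ↔ i = N.source := by
  simp [inChannels]

@[simp]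
theorem inr_mem_inChannels {w : ℕ} {e : E} {i : V} :
    (Sum.inr e : Fin w ⊕ E) ∈ N.inChannels w i ↔ N.head e = i := by
  simp [inChannels]

namespace LinearCode

variable {F : Type*} [Field F] {w : ℕ} (c : N.LinearCode F w)

/-- The symbol carried by the channel `e` when the message `x` is sent and the error vector `Z`
is added to the channels. -/
noncomputable def signal (x : Fin w → F) (Z : E → F) (e : E) : F :=
  Sum.elim x Z ⬝ᵥ c.kernel e

theorem signal_eq (x : Fin w → F) (Z : E → F) (e : E) : c.signal x Z e =
    ∑ d ∈ N.inChannels w (N.tail e), c.k d e * Sum.elim x (c.signal x Z) d + Z e := by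
  classical
  rw [signal, kernel_eq, dotProduct_add, dotProduct_sum]
  congr 1
  · refine Finset.sum_congr rfl fun d _ => ?_
    rw [dotProduct_smul, smul_eq_mul]
    rcases d with d | d
    · simp
    · rfl
  · simp

/-- The propagation rule has a unique solution, as the network is acyclic. -/
theorem eq_signal {x : Fin w → F} {Z u : E → F}
    (h : ∀ e, u e = ∑ d ∈ N.inChannels w (N.tail e), c.k d e * Sum.elim x u d + Z e) :
    u = c.signal x Z := by
  ext e
  induction e using N.wellFounded_adj.induction with
  | _ e ih =>
    rw [h, signal_eq]
    congr 1
    refine Finset.sum_congr rfl fun d hd => ?_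
    rcases d with d | d
    · rfl
    · simp [ih d (by simpa using hd)]

theorem signal_add (x x' : Fin w → F) (Z Z' : E → F) (e : E) :
    c.signal (x + x') (Z + Z') e = c.signal x Z e + c.signal x' Z' e := by
  rw [signal, signal, signal, ← add_dotProduct]
  congr 1
  ext (i | i) <;> simp

theorem signal_smul (a : F) (x : Fin w → F) (Z : E → F) (e : E) :
    c.signal (a • x) (a • Z) e = a * c.signal x Z e := by
  rw [signal, signal, ← smul_eq_mul, ← smul_dotProduct]
  congr 1
  ext (i | i) <;> simp

theorem mem_messageSpace {t : V} {v : {e : E // N.head e = t} → F} :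
    v ∈ c.messageSpace t ↔ ∃ x : Fin w → F, v = fun e => c.signal x 0 e.1 := Iff.rfl

theorem errorSpace_mono {t : V} {ρ ρ' : Finset E} (h : ρ ⊆ ρ') :
    c.errorSpace t ρ ≤ c.errorSpace t ρ' := by
  rintro _ ⟨Z, hZ, rfl⟩
  exact ⟨Z, fun e he => hZ e fun h' => he (h h'), rfl⟩

open Classical in
/-- The code in which only the channels of `Y` forward what their tail receives. -/
noncomputable def restrict (Y : Finset E) : N.LinearCode F w where
  k d e := if e ∈ Y then c.k d e else 0
  k_eq_zero d e h := by simp [c.k_eq_zero d e h]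

theorem restrict_signal_of_mem {Y : Finset E} (x : Fin w → F) (Z : E → F) {e : E} (he : e ∈ Y) :
    (c.restrict Y).signal x Z e = ∑ d ∈ N.inChannels w (N.tail e),
      c.k d e * Sum.elim x ((c.restrict Y).signal x Z) d + Z e := by
  rw [signal_eq]
  simp [restrict, he]

theorem restrict_signal_of_notMem {Y : Finset E} (x : Fin w → F) (Z : E → F) {e : E}
    (he : e ∉ Y) : (c.restrict Y).signal x Z e = Z e := by
  rw [signal_eq]
  simp [restrict, he]

end LinearCode

end Signals

/-! ### Separating sets and domination -/

section Separation

/-- The set `C` separates the channels of `X` from the node `t`, witnessed by a set `Y` of channels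
that contains `X` outside `C`, that can be left only through `C`, and that does not enter `t`. -/
def Separates (N : Network V E) (t : V) (X C : Set E) : Prop :=
  ∃ Y : Set E, (∀ e ∈ Y, N.head e ≠ t) ∧ (∀ e ∈ X, e ∈ Y ∨ e ∈ C) ∧
    ∀ d ∈ Y, ∀ e, N.head d = N.tail e → e ∈ Y ∨ e ∈ C

/-- The channels reachable from `X` by paths that avoid `C`. -/
inductive Reach (N : Network V E) (X C : Set E) : E → Prop
  | start {e : E} : e ∈ X → e ∉ C → Reach N X C e
  | step {d e : E} : Reach N X C d → N.head d = N.tail e → e ∉ C → Reach N X C e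

theorem separates_of_reach {t : V} {X C : Set E} (h : ∀ e, N.Reach X C e → N.head e ≠ t) :
    N.Separates t X C :=
  ⟨{e | N.Reach X C e}, h, fun e he => by
    by_cases heC : e ∈ C
    · exact Or.inr heC
    · exact Or.inl (.start he heC), fun d hd e hde => by
    by_cases heC : e ∈ C
    · exact Or.inr heC
    · exact Or.inl (Reach.step hd hde heC)⟩

theorem Separates.isCut {t : V} {C : Finset E}
    (h : N.Separates t {e | N.tail e = N.source} C) : N.IsCut N.source t C := by
  obtain ⟨Y, hYt, hXY, hY⟩ := h
  have key : ∀ p : List E, ∀ d, d ∈ Y → (d :: p).IsChain (fun d e => N.head d = N.tail e) →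
      (d :: p).getLast?.map N.head = some t → ∃ e ∈ p, e ∈ C := by
    intro p
    induction p with
    | nil =>
      intro d hd _ hl
      exact absurd (by simpa using hl) (hYt d hd)
    | cons e p ih =>
      intro d hd hc hl
      rw [List.isChain_cons_cons] at hc
      rcases hY d hd e hc.1 with he | he
      · obtain ⟨e', he', hC⟩ := ih e he hc.2 (by simpa using hl)
        exact ⟨e', by simp [he'], hC⟩
      · exact ⟨e, by simp, he⟩
  rintro p ⟨hh, hl, hc⟩
  cases p with
  | nil => simp at hh
  | cons d p =>
    rcases hXY d (by simpa using hh) with hd | hd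
    · obtain ⟨e, he, hC⟩ := key p d hd hc hl
      exact ⟨e, by simp [he], hC⟩
    · exact ⟨d, by simp, hd⟩

theorem IsCut.separates {t : V} {C : Finset E} (h : N.IsCut N.source t C) :
    N.Separates t {e | N.tail e = N.source} C := by
  have key : ∀ e, N.Reach {e | N.tail e = N.source} C e →
      ∃ p, N.IsPath N.source (N.head e) p ∧ p.getLast? = some e ∧ ∀ d ∈ p, d ∉ C := by
    intro e he
    induction he with
    | @start e he heC =>
      exact ⟨[e], ⟨by simpa using he, by simp, by simp⟩, by simp, by simpa using heC⟩
    | @step d e _ hde heC ih =>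
      obtain ⟨p, ⟨hh, _, hc⟩, hl, hC⟩ := ih
      refine ⟨p ++ [e], ⟨?_, by simp, ?_⟩, by simp, ?_⟩
      · cases p with
        | nil => simp at hh
        | cons a p => simpa using hh
      · rw [List.isChain_append]
        refine ⟨hc, by simp, ?_⟩
        simp [hl, hde]
      · intro a ha
        rcases List.mem_append.1 ha with ha | ha
        · exact hC a ha
        · rw [List.mem_singleton.1 ha]
          exact heC
  refine separates_of_reach fun e he het => ?_
  obtain ⟨p, hp, _, hC⟩ := key e he
  obtain ⟨a, ha, haC⟩ := h p (het ▸ hp)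
  exact hC a ha haC

theorem minCut_le_card {t : V} {C : Finset E}
    (h : N.Separates t {e | N.tail e = N.source} C) : N.minCut N.source t ≤ C.card :=
  Nat.sInf_le ⟨C, h.isCut, rfl⟩

variable [Fintype E]

theorem exists_separates_card_eq_minCut (N : Network V E) (t : V) : ∃ C : Finset E,
    N.Separates t {e | N.tail e = N.source} C ∧ C.card = N.minCut N.source t := by
  have hne : {n | ∃ C : Finset E, N.IsCut N.source t C ∧ C.card = n}.Nonempty := by
    refine ⟨_, Finset.univ, ?_, rfl⟩
    rintro p ⟨hh, -⟩
    cases p with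
    | nil => simp at hh
    | cons d p => exact ⟨d, by simp⟩
  obtain ⟨C, hC, hcard⟩ := Nat.sInf_mem hne
  exact ⟨C, hC.separates, hcard⟩

variable {F : Type*} [Field F]

/-- An error on `ρ` can be moved to a set `C` separating `ρ` from `t`: the signal is split into the
part travelling inside the set that witnesses the separation, which never enters `t`, and the rest,
which is the response to the errors that the first part induces on `C`. -/
theorem Separates.dominated {t : V} {ρ C : Finset E} (h : N.Separates t ρ C) :
    N.Dominated F t ρ C := by
  classical
  obtain ⟨Y', hYt, hXY, hY⟩ := h
  set Y : Finset E := Finset.univ.filter (· ∈ Y') with hYdef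
  have hmem : ∀ e, e ∈ Y ↔ e ∈ Y' := by simp [hYdef]
  rintro w c _ ⟨Z, hZ, rfl⟩
  set u := c.signal 0 Z with hu
  set a := (c.restrict Y).signal 0 (fun e => if e ∈ Y then Z e else 0) with ha
  have ha0 : ∀ e, e ∉ Y → a e = 0 := fun e he => by
    rw [ha, c.restrict_signal_of_notMem _ _ he, if_neg he]
  set Z' : E → F := fun e => if e ∈ Y then 0 else
    ∑ d ∈ N.inChannels w (N.tail e), c.k d e * Sum.elim (0 : Fin w → F) a d + Z e with hZ'
  have hb : (fun e => u e - a e) = c.signal 0 Z' := by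
    refine c.eq_signal fun e => ?_
    have hsum : ∑ d ∈ N.inChannels w (N.tail e),
          c.k d e * Sum.elim (0 : Fin w → F) (fun e => u e - a e) d =
        ∑ d ∈ N.inChannels w (N.tail e), c.k d e * Sum.elim (0 : Fin w → F) u d -
        ∑ d ∈ N.inChannels w (N.tail e), c.k d e * Sum.elim (0 : Fin w → F) a d := by
      rw [← Finset.sum_sub_distrib]
      refine Finset.sum_congr rfl fun d _ => ?_
      rcases d with d | d <;> simp [mul_sub]
    by_cases he : e ∈ Y
    · have h1 : a e = _ := c.restrict_signal_of_mem 0 _ he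
      rw [hsum, h1, hu, c.signal_eq 0 Z e]
      simp only [hZ', he, if_true]
      ring
    · rw [hsum, ha0 e he, hu, c.signal_eq 0 Z e]
      simp only [hZ', he, if_false]
      ring
  refine ⟨Z', fun e he => ?_, ?_⟩
  · by_cases heY : e ∈ Y
    · simp [hZ', heY]
    · have h1 : Z e = 0 := hZ e fun heρ => by
        rcases hXY e heρ with h | h
        · exact heY ((hmem e).2 h)
        · exact he h
      simp only [hZ', heY, if_false, h1, add_zero]
      refine Finset.sum_eq_zero fun d hd => ?_
      rcases d with d | d
      · simp
      · have hdY : d ∉ Y := fun hdY => by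
          rcases hY d ((hmem d).1 hdY) e (by simpa using hd) with h | h
          · exact heY ((hmem e).2 h)
          · exact he h
        simp [ha0 d hdY]
  · ext e
    have heY : e.1 ∉ Y := fun he => hYt e.1 ((hmem _).1 he) e.2
    change u e.1 = c.signal 0 Z' e.1
    rw [← congrFun hb e.1, ha0 _ heY, sub_zero]

/-- If `C` does not separate `ρ` from `t`, domination fails for the code in which every channel
that is reachable from `ρ` outside `C`, but not in `ρ`, forwards the symbol of one chosen reachable
predecessor, and no other channel forwards anything. -/
theorem Dominated.separates {t : V} {ρ C : Finset E} (h : N.Dominated F t ρ C) :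
    N.Separates t ρ C := by
  classical
  refine separates_of_reach fun e₀ he₀ het => ?_
  have hpred : ∀ e, N.Reach ρ C e ∧ e ∉ ρ → ∃ d, N.Reach ρ C d ∧ N.head d = N.tail e := by
    rintro e ⟨he, heρ⟩
    cases he with
    | start h _ => exact absurd h heρ
    | step hd hde _ => exact ⟨_, hd, hde⟩
  choose! p hp hpe using hpred
  let c : N.LinearCode F 0 :=
    { k := fun d e => if (N.Reach ρ C e ∧ e ∉ ρ) ∧ d = Sum.inr (p e) then 1 else 0
      k_eq_zero := by
        rintro d e hd
        refine if_neg ?_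
        rintro ⟨he, rfl⟩
        exact hd (by simpa using hpe e he) }
  have hsig : ∀ Z e, c.signal 0 Z e =
      (if N.Reach ρ C e ∧ e ∉ ρ then c.signal 0 Z (p e) else 0) + Z e := by
    intro Z e
    rw [c.signal_eq]
    congr 1
    split_ifs with he
    · rw [Finset.sum_eq_single_of_mem (Sum.inr (p e)) (by simpa using hpe e he)]
      · simp [c, he]
      · intro d _ hd
        simp [c, hd]
    · refine Finset.sum_eq_zero fun d _ => ?_
      simp only [c, he, false_and, if_false, zero_mul]
  have hC : ∀ Z : E → F, (∀ e, e ∉ C → Z e = 0) → ∀ e, N.Reach ρ C e → c.signal 0 Z e = 0 := by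
    intro Z hZ e he
    induction e using N.wellFounded_adj.induction with
    | _ e ih =>
      have heC : e ∉ C := by cases he <;> simpa using ‹_ ∉ _›
      rw [hsig, hZ e heC, add_zero]
      split_ifs with h
      · exact ih _ (hpe e h) (hp e h)
      · rfl
  have hρ : ∀ e, N.Reach ρ C e → c.signal 0 (fun e => if e ∈ ρ then 1 else 0) e = 1 := by
    intro e he
    induction e using N.wellFounded_adj.induction with
    | _ e ih =>
      rw [hsig]
      by_cases heρ : e ∈ ρ
      · simp [heρ]
      · rw [if_pos ⟨he, heρ⟩, ih _ (hpe e ⟨he, heρ⟩) (hp e ⟨he, heρ⟩)]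
        simp [heρ]
  obtain ⟨Z, hZ, hv⟩ := h 0 c ⟨fun e => if e ∈ ρ then 1 else 0, fun e he => if_neg he, rfl⟩
  have h1 : c.signal 0 (fun e => if e ∈ ρ then 1 else 0) e₀ = c.signal 0 Z e₀ :=
    congrFun hv ⟨e₀, het⟩
  rw [hρ e₀ he₀, hC Z hZ e₀ he₀] at h1
  exact one_ne_zero h1

/-! ### Ranks of error patterns -/

theorem rank_le_card {t : V} {ρ ρ' : Finset E} (h : N.Dominated F t ρ ρ') :
    N.rank F t ρ ≤ ρ'.card :=
  Nat.sInf_le ⟨ρ', h, rfl⟩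

theorem Dominated.refl (t : V) (ρ : Finset E) : N.Dominated F t ρ ρ := fun _ _ => le_rfl

theorem Dominated.trans {t : V} {ρ ρ' ρ'' : Finset E} (h : N.Dominated F t ρ ρ')
    (h' : N.Dominated F t ρ' ρ'') : N.Dominated F t ρ ρ'' :=
  fun w c => (h w c).trans (h' w c)

variable (N F) in
theorem exists_dominated_card_eq_rank (t : V) (ρ : Finset E) :
    ∃ ρ', N.Dominated F t ρ ρ' ∧ ρ'.card = N.rank F t ρ :=
  Nat.sInf_mem (s := {n | ∃ ρ' : Finset E, N.Dominated F t ρ ρ' ∧ ρ'.card = n})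
    ⟨_, ρ, Dominated.refl t ρ, rfl⟩

open Classical in
/-- The channels of `Y` together with the channels leaving the head of a channel of `Y`. -/
noncomputable def closedNbhd (N : Network V E) (Y : Finset E) : Finset E :=
  Y ∪ Finset.univ.filter fun e => ∃ d ∈ Y, N.head d = N.tail e

theorem mem_closedNbhd {Y : Finset E} {e : E} :
    e ∈ N.closedNbhd Y ↔ e ∈ Y ∨ ∃ d ∈ Y, N.head d = N.tail e := by
  simp [closedNbhd]

theorem subset_closedNbhd (Y : Finset E) : Y ⊆ N.closedNbhd Y :=
  fun _ he => mem_closedNbhd.2 (Or.inl he)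

open Classical in
theorem separates_sdiff {t : V} {X : Set E} {Y M : Finset E} (hY : ∀ e ∈ Y, N.head e ≠ t)
    (hX : ∀ e ∈ X, e ∈ M) (hM : N.closedNbhd Y ⊆ M) :
    N.Separates t X ((M \ Y : Finset E) : Set E) := by
  refine ⟨Y, hY, fun e he => ?_, fun d hd e hde => ?_⟩
  · by_cases heY : e ∈ Y
    · exact Or.inl heY
    · exact Or.inr (by simp [heY, hX e he])
  · by_cases heY : e ∈ Y
    · exact Or.inl heY
    · exact Or.inr (by simpa [heY] using hM (mem_closedNbhd.2 (Or.inr ⟨d, hd, hde⟩)))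

theorem card_add_rank_le {t : V} {ρ Y M : Finset E} (hY : ∀ e ∈ Y, N.head e ≠ t) (hρ : ρ ⊆ M)
    (hM : N.closedNbhd Y ⊆ M) : Y.card + N.rank F t ρ ≤ M.card := by
  classical
  have h := rank_le_card ((separates_sdiff hY hρ hM).dominated (F := F))
  rw [← Finset.card_sdiff_add_card_eq_card ((subset_closedNbhd Y).trans hM), add_comm]
  gcongr

theorem card_add_minCut_le {t : V} {Y M : Finset E} (hY : ∀ e ∈ Y, N.head e ≠ t)
    (hs : ∀ e, N.tail e = N.source → e ∈ M) (hM : N.closedNbhd Y ⊆ M) :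
    Y.card + N.minCut N.source t ≤ M.card := by
  classical
  have h := minCut_le_card (separates_sdiff (X := {e | N.tail e = N.source}) hY hs hM)
  rw [← Finset.card_sdiff_add_card_eq_card ((subset_closedNbhd Y).trans hM), add_comm]
  gcongr

open Classical in
variable (N F) in
/-- The bound `card_add_rank_le` is attained. -/
theorem exists_card_le_card_add_rank (t : V) (ρ : Finset E) : ∃ Y : Finset E,
    (∀ e ∈ Y, N.head e ≠ t) ∧ (N.closedNbhd Y ∪ ρ).card ≤ Y.card + N.rank F t ρ := by
  obtain ⟨C, hC, hcard⟩ := exists_dominated_card_eq_rank N F t ρ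
  obtain ⟨Y, hYt, hXY, hY⟩ := hC.separates
  refine ⟨Finset.univ.filter (· ∈ Y), by simpa using hYt, ?_⟩
  rw [← hcard]
  refine (Finset.card_le_card fun e he => ?_).trans (Finset.card_union_le _ _)
  rw [Finset.mem_union, mem_closedNbhd] at he
  simp only [Finset.mem_filter, Finset.mem_univ, true_and, Finset.mem_union] at he ⊢
  rcases he with (he | ⟨d, hd, hde⟩) | he
  · exact Or.inl he
  · exact hY d hd e hde
  · exact hXY e he

/-- A pattern of full rank below the minimum cut capacity can be enlarged to one of full rank.
Otherwise, by submodularity of `Y ↦ |N[Y] ∪ ρ| - |Y|`, the sets attaining the rank of the patterns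
`insert e ρ` can be merged into one `Y` with `N[Y] ∪ ρ` everything, and the complement of `Y` is a
cut of size `|ρ|`. -/
theorem exists_insert_full_rank {t : V} {ρ : Finset E} (hρ : N.rank F t ρ = ρ.card)
    (hlt : ρ.card < N.minCut N.source t) :
    ∃ ρ' : Finset E, ρ ⊆ ρ' ∧ ρ'.card = ρ.card + 1 ∧ N.rank F t ρ' = ρ.card + 1 := by
  classical
  by_contra! hcon
  have hrank : ∀ e, N.rank F t (insert e ρ) ≤ ρ.card := by
    intro e
    by_cases he : e ∈ ρ
    · rw [Finset.insert_eq_of_mem he, hρ]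
    · have h1 := rank_le_card (Dominated.refl (F := F) (N := N) t (insert e ρ))
      have h2 := hcon (insert e ρ) (Finset.subset_insert e ρ) (Finset.card_insert_of_notMem he)
      rw [Finset.card_insert_of_notMem he] at h1
      omega
  have key : ∀ S : Finset E, ∃ Y : Finset E, (∀ e ∈ Y, N.head e ≠ t) ∧
      (N.closedNbhd Y ∪ ρ).card ≤ Y.card + ρ.card ∧ S ⊆ N.closedNbhd Y ∪ ρ := by
    intro S
    induction S using Finset.induction_on with
    | empty => exact ⟨∅, by simp, by simp [closedNbhd], by simp⟩
    | insert e S _ ih =>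
      obtain ⟨Y₁, hY₁t, hY₁, hS⟩ := ih
      obtain ⟨Y₂, hY₂t, hY₂⟩ := exists_card_le_card_add_rank N F t (insert e ρ)
      have hunion : N.closedNbhd (Y₁ ∪ Y₂) ∪ ρ ⊆
          (N.closedNbhd Y₁ ∪ ρ) ∪ (N.closedNbhd Y₂ ∪ insert e ρ) := by
        intro a
        simp only [Finset.mem_union, mem_closedNbhd, Finset.mem_insert]
        grind
      have hunion' : N.closedNbhd Y₁ ∪ ρ ⊆ N.closedNbhd (Y₁ ∪ Y₂) ∪ ρ := by
        intro a
        simp only [Finset.mem_union, mem_closedNbhd]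
        grind
      have hinter : N.closedNbhd (Y₁ ∩ Y₂) ⊆
          (N.closedNbhd Y₁ ∪ ρ) ∩ (N.closedNbhd Y₂ ∪ insert e ρ) := by
        intro a
        simp only [Finset.mem_union, mem_closedNbhd, Finset.mem_inter]
        grind
      have hle := card_add_rank_le (F := F) (t := t) (ρ := ρ) (Y := Y₁ ∩ Y₂)
        (fun a ha => hY₁t a (Finset.mem_inter.1 ha).1)
        (fun a ha => by simp [ha]) hinter
      have hcard := Finset.card_union_add_card_inter (N.closedNbhd Y₁ ∪ ρ)
        (N.closedNbhd Y₂ ∪ insert e ρ)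
      have hcard' := Finset.card_union_add_card_inter Y₁ Y₂
      have hr := hrank e
      have ht : ∀ a ∈ Y₁ ∪ Y₂, N.head a ≠ t := fun a ha => by
        rcases Finset.mem_union.1 ha with ha | ha
        · exact hY₁t a ha
        · exact hY₂t a ha
      by_cases he : e ∈ N.closedNbhd (Y₁ ∪ Y₂) ∪ ρ
      · exact ⟨Y₁ ∪ Y₂, ht, by have := Finset.card_le_card hunion; omega,
          Finset.insert_subset he (hS.trans hunion')⟩
      · -- The set `Y₂` also witnesses the rank of `ρ`, so `e` is in its neighbourhood.
        exfalso
        have he₂ : e ∉ N.closedNbhd Y₂ ∪ ρ := fun h => he <| by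
          revert h
          simp only [Finset.mem_union, mem_closedNbhd]
          grind
        have h1 := card_add_rank_le (F := F) (t := t) (ρ := ρ) (Y := Y₂) hY₂t
          (M := N.closedNbhd Y₂ ∪ ρ) Finset.subset_union_right Finset.subset_union_left
        rw [Finset.union_insert, Finset.card_insert_of_notMem he₂] at hY₂
        omega
  obtain ⟨Y, hYt, hY, huniv⟩ := key Finset.univ
  have := card_add_minCut_le hYt (M := N.closedNbhd Y ∪ ρ)
    (fun e _ => huniv (Finset.mem_univ e)) Finset.subset_union_left
  omega

theorem exists_superset_full_rank {t : V} {ρ : Finset E} (hρ : N.rank F t ρ = ρ.card) {n : ℕ}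
    (hn : ρ.card ≤ n) (hle : n ≤ N.minCut N.source t) :
    ∃ ρ' : Finset E, ρ ⊆ ρ' ∧ ρ'.card = n ∧ N.rank F t ρ' = n := by
  induction n, hn using Nat.le_induction with
  | base => exact ⟨ρ, Finset.Subset.refl ρ, rfl, hρ⟩
  | succ n _ ih =>
    obtain ⟨ρ', hsub, hcard, hrank⟩ := ih (by omega)
    obtain ⟨ρ'', hsub', hcard', hrank'⟩ :=
      exists_insert_full_rank (N := N) (F := F) (t := t) (ρ := ρ') (by omega) (by omega)
    exact ⟨ρ'', hsub.trans hsub', by omega, by rw [hrank', hcard]⟩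

end Separation

variable [Fintype E]

/-! ### The Singleton bound -/

section Singleton

variable {F : Type*} [Field F] {w : ℕ}

/-- The Singleton bound: if messages can be decoded at `t`, some error pattern of size `C_t - w + 1`
can imitate a nonzero message. Take a minimum cut `C`, and let `ρ ⊆ C` leave out `w - 1` channels.
If the channels of `ρ` forward nothing, some nonzero message produces no symbol on `C \ ρ`, as this
imposes only `w - 1` linear conditions. In the original code, errors on `ρ` that cancel what this
message sends there therefore silence all of `C`, and with it the channels entering `t`. -/
theorem LinearCode.exists_errorSpace_inf_messageSpace_ne_bot (c : N.LinearCode F w) {t : V}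
    (hw : 1 ≤ w) (hcut : w ≤ N.minCut N.source t)
    (hinj : ∀ x : Fin w → F, (∀ e, N.head e = t → c.signal x 0 e = 0) → x = 0) :
    ∃ ρ : Finset E, ρ.card = N.redundancy w t + 1 ∧
      c.errorSpace t ρ ⊓ c.messageSpace t ≠ ⊥ := by
  classical
  obtain ⟨C, ⟨Y, hYt, hsY, hY⟩, hC⟩ := exists_separates_card_eq_minCut N t
  have hδ : N.redundancy w t = N.minCut N.source t - w := rfl
  obtain ⟨ρ, hρC, hρ⟩ :=
    Finset.exists_subset_card_eq (s := C) (n := N.redundancy w t + 1) (by omega)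
  refine ⟨ρ, hρ, ?_⟩
  let A : (Fin w → F) →ₗ[F] ({e // e ∈ C \ ρ} → F) :=
    { toFun := fun x e => (c.restrict ρᶜ).signal x 0 e
      map_add' := fun x y => by
        ext e
        simpa using (c.restrict ρᶜ).signal_add x y 0 0 e
      map_smul' := fun a x => by
        ext e
        simpa using (c.restrict ρᶜ).signal_smul a x 0 e }
  have hker : LinearMap.ker A ≠ ⊥ := by
    apply LinearMap.ker_ne_bot_of_finrank_lt
    rw [Module.finrank_fintype_fun_eq_card, Module.finrank_fintype_fun_eq_card, Fintype.card_fin,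
      Fintype.card_coe, Finset.card_sdiff_of_subset hρC]
    omega
  obtain ⟨x, hx, hx0⟩ := Submodule.exists_mem_ne_zero_of_ne_bot hker
  set a := (c.restrict ρᶜ).signal x 0 with ha
  have haρ : ∀ e ∈ ρ, a e = 0 := fun e he => by
    rw [ha, c.restrict_signal_of_notMem _ _ (by simpa using he)]
    rfl
  have haC : ∀ e ∈ C, a e = 0 := fun e he => by
    by_cases heρ : e ∈ ρ
    · exact haρ e heρ
    · exact congrFun (LinearMap.mem_ker.1 hx) ⟨e, Finset.mem_sdiff.2 ⟨he, heρ⟩⟩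
  have ha0 : ∀ e, e ∉ Y → a e = 0 := by
    intro e he
    induction e using N.wellFounded_adj.induction with
    | _ e ih =>
      by_cases heC : e ∈ C
      · exact haC e heC
      · rw [ha, c.restrict_signal_of_mem _ _ (by simpa using fun h => heC (hρC h))]
        rw [Pi.zero_apply, add_zero]
        refine Finset.sum_eq_zero fun d hd => ?_
        rcases d with d | d
        · have := hsY e (by simpa using hd)
          exact absurd this (by simp [he, heC])
        · have hde : N.head d = N.tail e := by simpa using hd
          have hdY : d ∉ Y := fun h => by
            have := hY d h e hde
            simp [he, heC] at this
          have := ih d hde hdY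
          simp [← ha, this]
  set Z : E → F := fun e => if e ∈ ρ then
    -∑ d ∈ N.inChannels w (N.tail e), c.k d e * Sum.elim x a d else 0 with hZ
  have haZ : a = c.signal x Z := by
    refine c.eq_signal fun e => ?_
    by_cases he : e ∈ ρ
    · simp [hZ, he, haρ e he]
    · simp only [hZ, he, if_false]
      rw [ha, c.restrict_signal_of_mem _ _ (by simpa using he)]
      rfl
  have hsum : ∀ e, N.head e = t → c.signal x 0 e = -c.signal 0 Z e := by
    intro e he
    have h1 := c.signal_add x 0 0 Z e
    rw [add_zero, zero_add, ← haZ, ha0 e fun h => hYt e h he] at h1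
    exact eq_neg_of_add_eq_zero_left h1.symm
  intro hbot
  refine hx0 (hinj x fun e he => ?_)
  have hmem : (fun e : {e // N.head e = t} => c.signal x 0 e.1) ∈
      c.errorSpace t ρ ⊓ c.messageSpace t := by
    refine ⟨?_, x, rfl⟩
    have : (fun e : {e // N.head e = t} => c.signal x 0 e.1) =
        -fun e : {e // N.head e = t} => c.signal 0 Z e.1 := by
      ext e
      exact hsum e.1 e.2
    rw [this]
    exact neg_mem ⟨Z, fun e he => by simp [hZ, he], rfl⟩
  rw [hbot, Submodule.mem_bot] at hmem
  exact congrFun hmem ⟨e, he⟩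

end Singleton

/-! ### Linkings -/

/-- A linking of the message channels and the error pattern `ρ` into `t`: an injective partial map
on the (message and network) channels, defined outside the channels entering `t`, that sends each
channel either to itself (the channel is unused) or to a channel leaving its head, and that avoids
`ρ`. As the network is acyclic, its orbits starting from the message channels and from `ρ` are
disjoint paths that end in channels entering `t`. -/
structure IsLinking (N : Network V E) {w : ℕ} (t : V) (ρ : Finset E) (σ : Fin w ⊕ E → E) :
    Prop where
  injOn : Set.InjOn σ {v | v ∉ N.inChannels w t}
  notMem : ∀ v, v ∉ N.inChannels w t → σ v ∉ ρ
  adj : ∀ v, v ∉ N.inChannels w t → v = Sum.inr (σ v) ∨ v ∈ N.inChannels w (N.tail (σ v))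

/-- Menger's theorem in the form needed here. For acyclic networks it is an instance of Hall's
marriage theorem: the neighbours of a set of channels, together with `ρ`, separate `ρ` (or, if the
set has message channels, the source) from `t`. -/
theorem exists_isLinking (F : Type*) [Field F] {w : ℕ} {t : V} {ρ : Finset E}
    (hρ : N.rank F t ρ = ρ.card) (hcut : w + ρ.card ≤ N.minCut N.source t) :
    ∃ σ : Fin w ⊕ E → E, N.IsLinking t ρ σ := by
  classical
  let T : {v : Fin w ⊕ E // v ∉ N.inChannels w t} → Finset E := fun v =>
    Finset.univ.filter fun e => e ∉ ρ ∧ (v.1 = Sum.inr e ∨ v.1 ∈ N.inChannels w (N.tail e))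
  have hall : ∀ s : Finset {v : Fin w ⊕ E // v ∉ N.inChannels w t},
      s.card ≤ (s.biUnion T).card := by
    intro s
    set S : Finset (Fin w ⊕ E) := s.map (Function.Embedding.subtype _) with hS
    have hmemS : ∀ v, v ∈ S ↔ ∃ h, (⟨v, h⟩ : {v // v ∉ N.inChannels w t}) ∈ s := by
      intro v
      simp [hS]
    have hcardS : s.card = S.toLeft.card + S.toRight.card := by
      rw [Finset.card_toLeft_add_card_toRight, hS, Finset.card_map]
    have hM : ∀ v ∈ S, ∀ e, (v = Sum.inr e ∨ v ∈ N.inChannels w (N.tail e)) →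
        e ∈ s.biUnion T ∪ ρ := by
      intro v hv e he
      by_cases heρ : e ∈ ρ
      · simp [heρ]
      · obtain ⟨h, hv⟩ := (hmemS v).1 hv
        exact Finset.mem_union_left _ (Finset.mem_biUnion.2 ⟨_, hv, by simp [T, heρ, he]⟩)
    have ht : ∀ e ∈ S.toRight, N.head e ≠ t := by
      intro e he het
      obtain ⟨h, -⟩ := (hmemS _).1 (Finset.mem_toRight.1 he)
      exact h (by simpa using het)
    have hsub : N.closedNbhd S.toRight ⊆ s.biUnion T ∪ ρ := by
      intro e he
      rcases mem_closedNbhd.1 he with he | ⟨d, hd, hde⟩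
      · exact hM _ (Finset.mem_toRight.1 he) e (Or.inl rfl)
      · exact hM _ (Finset.mem_toRight.1 hd) e (Or.inr (by simpa using hde))
    have hle := Finset.card_union_le (s.biUnion T) ρ
    by_cases hJ : S.toLeft = ∅
    · have := card_add_rank_le (F := F) ht (Finset.subset_union_right) hsub
      rw [hJ, Finset.card_empty] at hcardS
      omega
    · obtain ⟨j, hj⟩ := Finset.nonempty_iff_ne_empty.2 hJ
      have := card_add_minCut_le ht
        (fun e he => hM _ (Finset.mem_toLeft.1 hj) e (Or.inr (by simpa using he))) hsub
      have hJw : S.toLeft.card ≤ w := by simpa using Finset.card_le_univ S.toLeft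
      omega
  obtain ⟨f, hf, hfT⟩ := (Finset.all_card_le_biUnion_card_iff_exists_injective T).1 hall
  have hspec : ∀ v (h : v ∉ N.inChannels w t), f ⟨v, h⟩ ∉ ρ ∧
      (v = Sum.inr (f ⟨v, h⟩) ∨ v ∈ N.inChannels w (N.tail (f ⟨v, h⟩))) := by
    intro v h
    simpa [T] using hfT ⟨v, h⟩
  by_cases hE : Nonempty E
  · obtain ⟨e₀⟩ := hE
    refine ⟨fun v => if h : v ∉ N.inChannels w t then f ⟨v, h⟩ else e₀, ?_, ?_, ?_⟩
    · intro v hv v' hv' h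
      simp only [Set.mem_ofPred_eq] at hv hv'
      simp only [hv, hv', not_false_eq_true, dif_pos] at h
      exact congrArg Subtype.val (hf h)
    · intro v hv
      simpa only [hv, not_false_eq_true, dif_pos] using (hspec v hv).1
    · intro v hv
      simpa only [hv, not_false_eq_true, dif_pos] using (hspec v hv).2
  · have hemp : IsEmpty (Fin w ⊕ E) := by
      refine ⟨fun v => ?_⟩
      have h0 : N.minCut N.source t ≤ 0 := by
        have := minCut_le_card (N := N) (t := t) (C := ∅)
          ⟨∅, by simp, fun e => (hE ⟨e⟩).elim, by simp⟩
        simpa using this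
      rcases v with j | e
      · exact absurd j.isLt (by omega)
      · exact hE ⟨e⟩
    exact ⟨fun v => hemp.elim v, fun v => hemp.elim v, fun v => hemp.elim v, fun v => hemp.elim v⟩

/-! ### Unions of proper subspaces -/

/-- Over a field with at least `s.card` elements, `s.card` proper subspaces do not cover. -/
theorem exists_forall_notMem_of_card_le {ι K M : Type*} [Field K] [AddCommGroup M] [Module K M]
    (s : Finset ι) (p : ι → Submodule K M) (hp : ∀ i, p i ≠ ⊤)
    (hs : (s.card : ℕ∞) ≤ ENat.card K) : ∃ x, ∀ i ∈ s, x ∉ p i := by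
  classical
  induction s using Finset.induction_on with
  | empty => exact ⟨0, by simp⟩
  | insert j s hj ih =>
    rw [Finset.card_insert_of_notMem hj] at hs
    have hlt : (s.card : ℕ∞) < ENat.card K :=
      lt_of_lt_of_le (by exact_mod_cast Nat.lt_succ_self _) hs
    obtain ⟨x, hx⟩ := ih hlt.le
    by_cases hxj : x ∉ p j
    · exact ⟨x, by simpa [hxj] using hx⟩
    rw [not_not] at hxj
    obtain ⟨y, -, hy⟩ := SetLike.exists_of_lt (lt_top_iff_ne_top.2 (hp j))
    -- Each `p i` with `i ∈ s` meets the line `y + K x` in at most one point, and `p j` misses it.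
    by_contra! hcon
    have hmem : ∀ a : K, ∃ i ∈ s, a • x + y ∈ p i := by
      intro a
      obtain ⟨i, hi, h⟩ := hcon (a • x + y)
      rcases Finset.mem_insert.1 hi with rfl | hi
      · exact absurd (((p i).add_mem_iff_right ((p i).smul_mem a hxj)).1 h) hy
      · exact ⟨i, hi, h⟩
    choose g hg hgp using hmem
    have hinj : Function.Injective fun a => (⟨g a, hg a⟩ : s) := by
      intro a b hab
      have hab : g a = g b := congrArg Subtype.val hab
      by_contra hne
      have h1 := (p (g a)).sub_mem (hgp a) (hab ▸ hgp b)
      rw [add_sub_add_right_eq_sub, ← sub_smul,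
        Submodule.smul_mem_iff _ (sub_ne_zero.2 hne)] at h1
      exact hx _ (hg a) h1
    have hcard := ENat.card_le_card_of_injective hinj
    rw [ENat.card_eq_coe_fintype_card (α := s), Fintype.card_coe] at hcard
    exact absurd hlt (not_lt.2 hcard)

/-! ### Building a code channel by channel -/

section Construction

variable {F : Type*} [Field F] {w : ℕ}

/-- A set of channels is closed upstream if it contains all channels from which it can be reached.
Such sets are the possible stages of the construction. -/
def IsUpstreamClosed (N : Network V E) (P : Finset E) : Prop :=
  ∀ e ∈ P, ∀ d, N.head d = N.tail e → d ∈ P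

namespace LinearCode

variable (c : N.LinearCode F w)

theorem kernel_congr {c c' : N.LinearCode F w} {P : Finset E} (hP : N.IsUpstreamClosed P)
    (h : ∀ e ∈ P, ∀ d, c.k d e = c'.k d e) {e : E} (he : e ∈ P) : c.kernel e = c'.kernel e := by
  induction e using N.wellFounded_adj.induction with
  | _ e ih =>
    rw [kernel_eq, kernel_eq]
    congr 1
    refine Finset.sum_congr rfl fun d hd => ?_
    rw [h e he]
    rcases d with d | d
    · rfl
    · have hde : N.head d = N.tail e := by simpa using hd
      simp [ih d hde (hP e he d hde)]

theorem kernel_apply_eq_zero {P : Finset E} (hP : N.IsUpstreamClosed P) {e e' : E} (he : e ∈ P)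
    (he' : e' ∉ P) : c.kernel e (Sum.inr e') = 0 := by
  classical
  induction e using N.wellFounded_adj.induction with
  | _ e ih =>
    have hne : e' ≠ e := fun h => he' (h ▸ he)
    rw [kernel_eq, Pi.add_apply, Finset.sum_apply, Pi.single_apply,
      if_neg (by simpa using hne), add_zero]
    refine Finset.sum_eq_zero fun d hd => ?_
    rcases d with d | d
    · simp
    · have hde : N.head d = N.tail e := by simpa using hd
      simp [ih d hde (hP e he d hde)]

open Classical in
/-- The code obtained from `c` by giving the channel `e` the coefficients `κ`. -/
noncomputable def update (e : E) (κ : Fin w ⊕ E → F) : N.LinearCode F w where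
  k d e' := if e' = e then (if d ∈ N.inChannels w (N.tail e) then κ d else 0) else c.k d e'
  k_eq_zero d e' h := by
    split_ifs with h₁ h₂
    · exact absurd h₂ (h₁ ▸ h)
    · rfl
    · exact c.k_eq_zero d e' h

open Classical in
/-- The kernels at stage `P` of the construction: channels outside `P` have their own indicator. -/
noncomputable def stageKernel (P : Finset E) : Fin w ⊕ E → (Fin w ⊕ E → F) :=
  Sum.elim (fun j => Pi.single (Sum.inl j) 1)
    fun e => if e ∈ P then c.kernel e else Pi.single (Sum.inr e) 1

theorem stageKernel_apply_eq_zero {P : Finset E} (hP : N.IsUpstreamClosed P) {e : E} (he : e ∉ P)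
    {d : Fin w ⊕ E} (hd : d ≠ Sum.inr e) : c.stageKernel P d (Sum.inr e) = 0 := by
  classical
  rcases d with d | d
  · simp [stageKernel]
  · by_cases hdP : d ∈ P
    · simpa [stageKernel, hdP] using c.kernel_apply_eq_zero hP hdP he
    · simp only [stageKernel, Sum.elim_inr, hdP, if_false]
      rw [Pi.single_apply, if_neg hd.symm]

/-- The linear combination of the kernels of the channels entering the tail of `e` with
coefficients `κ`, as a linear function of `κ`. -/
noncomputable def combine (P : Finset E) (e : E) :
    (Fin w ⊕ E → F) →ₗ[F] (Fin w ⊕ E → F) :=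
  ∑ d ∈ N.inChannels w (N.tail e), (LinearMap.proj d).smulRight (c.stageKernel P d)

theorem combine_apply (P : Finset E) (e : E) (κ : Fin w ⊕ E → F) :
    c.combine P e κ = ∑ d ∈ N.inChannels w (N.tail e), κ d • c.stageKernel P d := by
  simp [combine]

theorem combine_single [DecidableEq E] (P : Finset E) {e : E} {d : Fin w ⊕ E}
    (hd : d ∈ N.inChannels w (N.tail e)) :
    c.combine P e (Pi.single d 1) = c.stageKernel P d := by
  rw [combine_apply, Finset.sum_eq_single_of_mem d hd]
  · simp
  · intro b _ hb
    simp [Pi.single_eq_of_ne hb]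

variable {P : Finset E} {e : E}

theorem stageKernel_update_of_ne (hP : N.IsUpstreamClosed P) (he : e ∉ P) [DecidableEq E]
    (κ : Fin w ⊕ E → F) {d : Fin w ⊕ E} (hd : d ≠ Sum.inr e) :
    (c.update e κ).stageKernel (insert e P) d = c.stageKernel P d := by
  rcases d with d | d
  · simp [stageKernel]
  · have hde : d ≠ e := fun h => hd (h ▸ rfl)
    by_cases hdP : d ∈ P
    · have : (c.update e κ).kernel d = c.kernel d := by
        refine kernel_congr hP (fun a ha b => ?_) hdP
        have : a ≠ e := fun h => he (h ▸ ha)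
        simp [update, this]
      simp [stageKernel, hdP, this]
    · simp [stageKernel, hdP, hde]

theorem stageKernel_update_self (hP : N.IsUpstreamClosed P) (he : e ∉ P)
    (hpred : ∀ d, N.head d = N.tail e → d ∈ P) [DecidableEq E] (κ : Fin w ⊕ E → F) :
    (c.update e κ).stageKernel (insert e P) (Sum.inr e) =
      c.combine P e κ + Pi.single (Sum.inr e) 1 := by
  have h : (c.update e κ).stageKernel (insert e P) (Sum.inr e) = (c.update e κ).kernel e := by
    simp [stageKernel]
  rw [h, kernel_eq, combine_apply]
  congr 1
  · refine Finset.sum_congr rfl fun d hd => ?_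
    have h1 : (c.update e κ).k d e = κ d := by simp [update, hd]
    have hne : d ≠ Sum.inr e := by
      rintro rfl
      exact he (hpred e (by simpa using hd))
    rw [h1, ← c.stageKernel_update_of_ne hP he κ hne]
    rcases d with d | d
    · rfl
    · have hdP := hpred d (by simpa using hd)
      simp [stageKernel, hdP]
  · ext i
    simp [Pi.single_apply]

end LinearCode

/-- The projection onto the coordinates of the message channels and of the error pattern `ρ`. -/
def coordProj (F : Type*) [Field F] (w : ℕ) (ρ : Finset E) :
    (Fin w ⊕ E → F) →ₗ[F] (Fin w ⊕ ρ → F) :=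
  LinearMap.funLeft F F (Sum.map id Subtype.val)

/-- The invariant of the construction at stage `P` for the pair `(t, ρ)` with linking `σ`. There is
a frontier `X`, consisting of the channels through which the disjoint paths described by `σ` leave
stage `P` or enter `t`, or of channels of `ρ` where a path is still to start. The kernels on `X`,
projected to the message channels and to `ρ`, are linearly independent. -/
def HasFrontier (c : N.LinearCode F w) (P : Finset E) (t : V) (ρ : Finset E)
    (σ : Fin w ⊕ E → E) : Prop :=
  ∃ X : Finset (Fin w ⊕ E), X.card = w + ρ.card ∧
    (∀ e, Sum.inr e ∈ X → e ∈ P ∨ e ∈ ρ) ∧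
    (∀ e ∈ ρ, e ∉ P → Sum.inr e ∈ X) ∧
    (∀ x ∈ X, x ∉ N.inChannels w t → σ x ∉ P) ∧
    LinearIndepOn F (fun x => coordProj F w ρ (c.stageKernel P x)) X

theorem hasFrontier_empty (c : N.LinearCode F w) (t : V) (ρ : Finset E) (σ : Fin w ⊕ E → E) :
    HasFrontier c ∅ t ρ σ := by
  classical
  refine ⟨Finset.univ.disjSum ρ, by simp, by simp, by simp, by simp, ?_⟩
  rw [linearIndepOn_finset_iff]
  intro f hf i hi
  obtain ⟨i', rfl⟩ : ∃ i' : Fin w ⊕ ρ, Sum.map id Subtype.val i' = i := by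
    rcases i with i | e
    · exact ⟨Sum.inl i, rfl⟩
    · exact ⟨Sum.inr ⟨e, by simpa using hi⟩, rfl⟩
  have h := congrFun hf i'
  have hs : ∀ x : Fin w ⊕ E, c.stageKernel ∅ x = Pi.single x 1 := by
    rintro (x | x) <;> simp [LinearCode.stageKernel]
  rw [Finset.sum_apply, Finset.sum_eq_single_of_mem _ hi] at h
  · simpa [coordProj, LinearMap.funLeft_apply, hs] using h
  · intro b _ hb
    simp [coordProj, LinearMap.funLeft_apply, hs, hb.symm]

/-- One step of the construction: for each pair `(t, ρ)`, the coefficients of the next channel `e`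
only have to avoid a proper subspace. If `e ∈ ρ`, the independent error coordinate of `e` preserves
the invariant for all coefficients, and if no path uses `e`, nothing changes. If a path continues
from `d` to `e`, the new kernel must not lie in the span of the frontier without `d`, which fails
to contain the kernel of `d`. -/
theorem HasFrontier.exists_submodule {c : N.LinearCode F w} {P : Finset E} {t : V}
    {ρ : Finset E} {σ : Fin w ⊕ E → E} (h : HasFrontier c P t ρ σ) (hσ : N.IsLinking t ρ σ)
    (hP : N.IsUpstreamClosed P) {e : E} (he : e ∉ P)
    (hpred : ∀ d, N.head d = N.tail e → d ∈ P) [DecidableEq E] :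
    ∃ p : Submodule F (Fin w ⊕ E → F), p ≠ ⊤ ∧
      ∀ κ, κ ∉ p → HasFrontier (c.update e κ) (insert e P) t ρ σ := by
  classical
  obtain ⟨X, hcard, hXP, hρX, hσX, hind⟩ := h
  have hnt : Nontrivial (Fin w ⊕ E → F) :=
    haveI : Nonempty (Fin w ⊕ E) := ⟨Sum.inr e⟩
    Function.nontrivial
  have heq : ∀ (κ : Fin w ⊕ E → F) (X' : Finset (Fin w ⊕ E)), Sum.inr e ∉ X' → X' ⊆ X →
      LinearIndepOn F
        (fun x => coordProj F w ρ ((c.update e κ).stageKernel (insert e P) x)) X' := by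
    intro κ X' heX' hX'
    refine (hind.mono (Finset.coe_subset.2 hX')).congr fun x hx => ?_
    have hne : x ≠ Sum.inr e := fun h => heX' (h ▸ hx)
    simp only [c.stageKernel_update_of_ne hP he κ hne]
  by_cases heρ : e ∈ ρ
  · refine ⟨⊥, bot_ne_top, fun κ _ => ⟨X, hcard, fun e' h => ?_, fun e' h h' => ?_,
      fun x hx hxt => ?_, ?_⟩⟩
    · exact (hXP e' h).imp_left (Finset.mem_insert_of_mem ·)
    · exact hρX e' h fun h'' => h' (Finset.mem_insert_of_mem h'')
    · rw [Finset.mem_insert, not_or]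
      exact ⟨fun h => hσ.notMem x hxt (h ▸ heρ), hσX x hx hxt⟩
    · have heX : Sum.inr e ∈ X := hρX e heρ he
      rw [← Finset.insert_erase heX, Finset.coe_insert]
      refine (heq κ _ (Finset.notMem_erase _ _) (Finset.erase_subset _ _)).insert fun hmem => ?_
      -- The coordinate of `e` vanishes on the rest of the frontier, but not at `e`.
      have hle : Submodule.span F ((fun x => coordProj F w ρ
          ((c.update e κ).stageKernel (insert e P) x)) '' (X.erase (Sum.inr e))) ≤
          LinearMap.ker (LinearMap.proj (R := F) (φ := fun _ : Fin w ⊕ ρ => F)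
            (Sum.inr ⟨e, heρ⟩)) := by
        rw [Submodule.span_le]
        rintro _ ⟨x, hx, rfl⟩
        have hne : x ≠ Sum.inr e := (Finset.mem_erase.1 hx).1
        change (c.update e κ).stageKernel (insert e P) x (Sum.inr e) = 0
        rw [c.stageKernel_update_of_ne hP he κ hne]
        exact c.stageKernel_apply_eq_zero hP he hne
      have h0 : (c.update e κ).stageKernel (insert e P) (Sum.inr e) (Sum.inr e) = 0 := hle hmem
      rw [c.stageKernel_update_self hP he hpred, Pi.add_apply, Pi.single_eq_same,
        c.combine_apply, Finset.sum_apply, Finset.sum_eq_zero, zero_add] at h0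
      · exact one_ne_zero h0
      · intro d hd
        have hne : d ≠ Sum.inr e := by
          rintro rfl
          exact he (hpred e (by simpa using hd))
        simp [c.stageKernel_apply_eq_zero hP he hne]
  have heX : Sum.inr e ∉ X := fun h => (hXP e h).elim he heρ
  by_cases hd : ∃ d ∈ X, d ∉ N.inChannels w t ∧ σ d = e
  · obtain ⟨d, hdX, hdt, hde⟩ := hd
    have hdne : d ≠ Sum.inr e := fun h => heX (h ▸ hdX)
    have hdin : d ∈ N.inChannels w (N.tail e) := by
      rcases hσ.adj d hdt with h | h
      · exact absurd (hde ▸ h) hdne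
      · exact hde ▸ h
    refine ⟨(Submodule.span F ((fun x => coordProj F w ρ (c.stageKernel P x)) ''
      (X.erase d))).comap (coordProj F w ρ ∘ₗ c.combine P e), fun htop => ?_, fun κ hκ =>
      ⟨insert (Sum.inr e) (X.erase d), ?_, fun e' h => ?_, fun e' h h' => ?_,
      fun x hx hxt => ?_, ?_⟩⟩
    · have hmem : (Pi.single d 1 : Fin w ⊕ E → F) ∈ (Submodule.span F
          ((fun x => coordProj F w ρ (c.stageKernel P x)) '' (X.erase d))).comap
            (coordProj F w ρ ∘ₗ c.combine P e) := htop ▸ Submodule.mem_top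
      rw [Submodule.mem_comap, LinearMap.comp_apply, c.combine_single P hdin] at hmem
      rw [← Finset.insert_erase hdX, Finset.coe_insert] at hind
      exact ((linearIndepOn_insert (by simp)).1 hind).2 hmem
    · rw [Finset.card_insert_of_notMem fun h => heX (Finset.mem_of_mem_erase h),
        Finset.card_erase_add_one hdX, hcard]
    · rcases Finset.mem_insert.1 h with h | h
      · exact Or.inl (Sum.inr.inj h ▸ Finset.mem_insert_self _ _)
      · exact (hXP e' (Finset.mem_of_mem_erase h)).imp_left (Finset.mem_insert_of_mem ·)
    · have hne : Sum.inr e' ≠ d := by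
        rintro rfl
        exact h' (Finset.mem_insert_of_mem (hpred e' (by simpa using hdin)))
      exact Finset.mem_insert_of_mem (Finset.mem_erase.2
        ⟨hne, hρX e' h fun h'' => h' (Finset.mem_insert_of_mem h'')⟩)
    · rw [Finset.mem_insert, not_or]
      have hxd : x ≠ d → σ x ≠ e := fun hne h => hne (hσ.injOn hxt hdt (h.trans hde.symm))
      rcases Finset.mem_insert.1 hx with rfl | hx
      · refine ⟨hxd hdne.symm, fun hmem => ?_⟩
        rcases hσ.adj _ hxt with h | h
        · exact hxd hdne.symm (Sum.inr.inj h).symm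
        · exact he (hP _ hmem e (by simpa using h))
      · exact ⟨hxd (Finset.ne_of_mem_erase hx), hσX x (Finset.mem_of_mem_erase hx) hxt⟩
    · have heX' : Sum.inr e ∉ X.erase d := fun h => heX (Finset.mem_of_mem_erase h)
      rw [Finset.coe_insert]
      refine (heq κ _ heX' (Finset.erase_subset _ _)).insert fun hmem => hκ ?_
      have himg : (fun x => coordProj F w ρ ((c.update e κ).stageKernel (insert e P) x)) ''
          (X.erase d) = (fun x => coordProj F w ρ (c.stageKernel P x)) '' (X.erase d) := by
        refine Set.image_congr fun x hx => ?_
        have hne : x ≠ Sum.inr e := fun h => heX' (h ▸ hx)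
        simp only [c.stageKernel_update_of_ne hP he κ hne]
      have hzero : coordProj F w ρ (Pi.single (Sum.inr e) 1) = 0 := by
        ext i
        rcases i with i | i
        · simp [coordProj, LinearMap.funLeft_apply]
        · have : i.1 ≠ e := fun h => heρ (h ▸ i.2)
          simp [coordProj, LinearMap.funLeft_apply, this]
      rw [himg, c.stageKernel_update_self hP he hpred, map_add, hzero, add_zero] at hmem
      exact hmem
  · push Not at hd
    refine ⟨⊥, bot_ne_top, fun κ _ => ⟨X, hcard, fun e' h => ?_, fun e' h h' => ?_,
      fun x hx hxt => ?_, heq κ X heX (Finset.Subset.refl X)⟩⟩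
    · exact (hXP e' h).imp_left (Finset.mem_insert_of_mem ·)
    · exact hρX e' h fun h'' => h' (Finset.mem_insert_of_mem h'')
    · rw [Finset.mem_insert, not_or]
      exact ⟨hd x hx hxt, hσX x hx hxt⟩

/-- The construction can be carried out at once for a family of at most `|F|` pairs `(t, ρ)`. -/
theorem exists_code_hasFrontier {ι : Type*} [Fintype ι] (t : ι → V) (ρ : ι → Finset E)
    (σ : ι → Fin w ⊕ E → E) (hσ : ∀ q, N.IsLinking (t q) (ρ q) (σ q))
    (hι : (Fintype.card ι : ℕ∞) ≤ ENat.card F) :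
    ∃ c : N.LinearCode F w, ∀ q, HasFrontier c Finset.univ (t q) (ρ q) (σ q) := by
  classical
  let good : Finset (Finset E) := Finset.univ.filter fun P => N.IsUpstreamClosed P ∧
    ∃ c : N.LinearCode F w, ∀ q, HasFrontier c P (t q) (ρ q) (σ q)
  have hempty : ∅ ∈ good := by
    refine Finset.mem_filter.2 ⟨Finset.mem_univ _, by simp [IsUpstreamClosed], ⟨0, by simp⟩, ?_⟩
    exact fun q => hasFrontier_empty _ _ _ _
  obtain ⟨P, hPgood, hmax⟩ := good.exists_max_image Finset.card ⟨∅, hempty⟩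
  obtain ⟨-, hP, c, hc⟩ := Finset.mem_filter.1 hPgood
  by_cases huniv : P = Finset.univ
  · exact ⟨c, huniv ▸ hc⟩
  exfalso
  have hne : {e | e ∉ P}.Nonempty := by
    by_contra h
    exact huniv (Finset.eq_univ_iff_forall.2 fun e => by
      by_contra he
      exact h ⟨e, he⟩)
  obtain ⟨e, he, hmin⟩ := N.wellFounded_adj.has_min _ hne
  have hpred : ∀ d, N.head d = N.tail e → d ∈ P := fun d hd => by
    by_contra h
    exact hmin d h hd
  have hstep : ∀ q, ∃ p : Submodule F (Fin w ⊕ E → F), p ≠ ⊤ ∧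
      ∀ κ, κ ∉ p → HasFrontier (c.update e κ) (insert e P) (t q) (ρ q) (σ q) := fun q =>
    (hc q).exists_submodule (hσ q) hP he hpred
  choose p hp hpκ using hstep
  obtain ⟨κ, hκ⟩ := exists_forall_notMem_of_card_le Finset.univ p hp hι
  have hmem : insert e P ∈ good := by
    refine Finset.mem_filter.2 ⟨Finset.mem_univ _, fun a ha d hd => ?_, c.update e κ,
      fun q => hpκ q κ (hκ q (Finset.mem_univ q))⟩
    rcases Finset.mem_insert.1 ha with rfl | ha
    · exact Finset.mem_insert_of_mem (hpred d hd)
    · exact Finset.mem_insert_of_mem (hP a ha d hd)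
  have := hmax _ hmem
  rw [Finset.card_insert_of_notMem he] at this
  omega

/-- At the end of the construction the frontier lies in `t`, so that the kernels of the channels
entering `t` span all message and `ρ`-error coordinates: a message that an error on `ρ` can
cancel at `t` is zero. -/
theorem HasFrontier.eq_zero_of_signal_eq_zero {c : N.LinearCode F w} {t : V} {ρ : Finset E}
    {σ : Fin w ⊕ E → E} (h : HasFrontier c Finset.univ t ρ σ) (ht : t ≠ N.source)
    {x : Fin w → F} {Z : E → F} (hZ : ∀ e, e ∉ ρ → Z e = 0)
    (hsig : ∀ e, N.head e = t → c.signal x Z e = 0) : x = 0 := by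
  classical
  obtain ⟨X, hcard, -, -, hσX, hind⟩ := h
  set y : Fin w ⊕ ρ → F := Sum.elim x fun e => Z e with hy
  have hdot : ∀ v : Fin w ⊕ E → F, Sum.elim x Z ⬝ᵥ v = y ⬝ᵥ coordProj F w ρ v := by
    intro v
    simp only [dotProduct, Fintype.sum_sum_type, hy, Sum.elim_inl, Sum.elim_inr, coordProj,
      LinearMap.funLeft_apply, Sum.map_inl, Sum.map_inr, id]
    congr 1
    rw [Finset.sum_coe_sort ρ fun e => Z e * v (Sum.inr e)]
    exact (Finset.sum_subset (Finset.subset_univ ρ) fun e _ he => by simp [hZ e he]).symm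
  have hspan : Submodule.span F (Set.range fun i : (X : Set (Fin w ⊕ E)) =>
      coordProj F w ρ (c.stageKernel Finset.univ i)) = ⊤ := by
    refine LinearIndependent.span_eq_top_of_card_eq_finrank' hind ?_
    rw [Module.finrank_fintype_fun_eq_card]
    simpa using hcard
  have hker : Submodule.span F (Set.range fun i : (X : Set (Fin w ⊕ E)) =>
      coordProj F w ρ (c.stageKernel Finset.univ i)) ≤
      LinearMap.ker (dotProductBilin F F y) := by
    rw [Submodule.span_le]
    rintro _ ⟨⟨i, hi⟩, rfl⟩
    have hit : i ∈ N.inChannels w t := by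
      by_contra hit
      exact hσX i hi hit (Finset.mem_univ _)
    rcases i with j | e
    · exact absurd (by simpa using hit) ht
    · change y ⬝ᵥ coordProj F w ρ (c.stageKernel Finset.univ (Sum.inr e)) = 0
      rw [← hdot]
      simpa [LinearCode.stageKernel, LinearCode.signal] using hsig e (by simpa using hit)
  ext j
  have hj : (Pi.single (Sum.inl j) 1 : Fin w ⊕ ρ → F) ∈ LinearMap.ker (dotProductBilin F F y) :=
    hker (hspan ▸ Submodule.mem_top)
  have : y ⬝ᵥ Pi.single (Sum.inl j) 1 = 0 := hj
  simpa [hy] using this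

end Construction

/-! ### Distance of the constructed code -/

section Distance

variable {F : Type*} [Field F] {w : ℕ} {c : N.LinearCode F w}

theorem LinearCode.finrank_messageSpace {t : V}
    (hinj : ∀ x : Fin w → F, (∀ e, N.head e = t → c.signal x 0 e = 0) → x = 0) :
    Module.finrank F (c.messageSpace t) = w := by
  let A : (Fin w → F) →ₗ[F] ({e // N.head e = t} → F) :=
    { toFun := fun x e => c.signal x 0 e
      map_add' := fun x y => by
        ext e
        simpa using c.signal_add x y 0 0 e
      map_smul' := fun a x => by
        ext e
        simpa using c.signal_smul a x 0 e }
  have hA : Function.Injective A := by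
    rw [← LinearMap.ker_eq_bot, LinearMap.ker_eq_bot']
    exact fun x hx => hinj x fun e he => congrFun hx ⟨e, he⟩
  have hrange : c.messageSpace t = LinearMap.range A := by
    ext v
    rw [c.mem_messageSpace, LinearMap.mem_range]
    exact exists_congr fun x => eq_comm
  rw [hrange, LinearMap.finrank_range_of_inj hA, Module.finrank_fintype_fun_eq_card,
    Fintype.card_fin]

/-- A code attains the Singleton bound at `t` if no error pattern of size and rank `δ_t` can imitate
a nonzero message: every pattern of smaller rank is dominated by such a pattern. -/
theorem LinearCode.minDistance_eq {t : V} (hw : 1 ≤ w) (hcut : w ≤ N.minCut N.source t)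
    (hinj : ∀ x : Fin w → F, (∀ e, N.head e = t → c.signal x 0 e = 0) → x = 0)
    (hbot : ∀ ρ ∈ N.fullRankPatterns F t (N.redundancy w t),
      c.errorSpace t ρ ⊓ c.messageSpace t = ⊥) :
    c.minDistance t = N.redundancy w t + 1 := by
  have hδ : N.redundancy w t = N.minCut N.source t - w := rfl
  have hlow : ∀ ρ : Finset E, c.errorSpace t ρ ⊓ c.messageSpace t ≠ ⊥ →
      N.redundancy w t + 1 ≤ N.rank F t ρ := by
    intro ρ hρ
    by_contra! hlt
    obtain ⟨ρ', hdom, hcard⟩ := exists_dominated_card_eq_rank N F t ρ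
    have hfull : N.rank F t ρ' = ρ'.card := by
      refine le_antisymm (rank_le_card (Dominated.refl t ρ')) ?_
      obtain ⟨ρ'', hdom', hcard'⟩ := exists_dominated_card_eq_rank N F t ρ'
      rw [hcard, ← hcard']
      exact rank_le_card (hdom.trans hdom')
    obtain ⟨ρ'', hsub, hcard'', hrank''⟩ :=
      exists_superset_full_rank hfull (n := N.redundancy w t) (by omega) (by omega)
    refine hρ (le_bot_iff.1 ?_)
    rw [← hbot ρ'' (by simp [fullRankPatterns, hcard'', hrank''])]
    exact inf_le_inf_right _ ((hdom w c).trans (c.errorSpace_mono hsub))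
  obtain ⟨ρ, hρ, hne⟩ := c.exists_errorSpace_inf_messageSpace_ne_bot hw hcut hinj
  have hpos : ∀ ρ : Finset E, 0 < Module.finrank F ↥(c.errorSpace t ρ ⊓ c.messageSpace t) ↔
      c.errorSpace t ρ ⊓ c.messageSpace t ≠ ⊥ := by
    intro ρ
    rw [Module.finrank_pos_iff, Submodule.nontrivial_iff_ne_bot]
  have hmem : N.rank F t ρ ∈ {n | ∃ ρ : Finset E,
      0 < Module.finrank F ↥(c.errorSpace t ρ ⊓ c.messageSpace t) ∧ N.rank F t ρ = n} :=
    ⟨ρ, (hpos ρ).2 hne, rfl⟩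
  refine le_antisymm ?_ (le_csInf ⟨_, hmem⟩ ?_)
  · rw [← hρ]
    exact (Nat.sInf_le hmem).trans (rank_le_card (Dominated.refl t ρ))
  · rintro _ ⟨ρ', hρ', rfl⟩
    exact hlow ρ' ((hpos ρ').1 hρ')

end Distance

end Network

end NEC

theorem mainTheorem2 {V E F : Type*} [Finite V] [Fintype E] [Field F]
    (N : NEC.Network V E) (w : ℕ) (hw : 1 ≤ w)
    (hcut : ∀ t ∈ N.sinks, w ≤ N.minCut N.source t)
    (hF : ((∑ t ∈ N.sinks, (N.fullRankPatterns F t (N.redundancy w t)).card : ℕ) : ℕ∞)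
      ≤ ENat.card F) :
    ∃ c : N.LinearCode F w, c.IsMDS := by
  classical
  let R : V → Finset (Finset E) := fun t => N.fullRankPatterns F t (N.redundancy w t)
  have hR : ∀ {t ρ}, ρ ∈ R t → ρ.card = N.redundancy w t ∧ N.rank F t ρ = N.redundancy w t := by
    intro t ρ hρ
    simpa [R, NEC.Network.fullRankPatterns] using hρ
  let Q : Finset (V × Finset E) := (N.sinks.sigma R).map (Equiv.sigmaEquivProd V _).toEmbedding
  have hQ : ∀ {t ρ}, (t, ρ) ∈ Q ↔ t ∈ N.sinks ∧ ρ ∈ R t := by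
    simp [Q]
  have hlink : ∀ q : Q, ∃ σ : Fin w ⊕ E → E, N.IsLinking q.1.1 q.1.2 σ := by
    rintro ⟨⟨t, ρ⟩, hq⟩
    obtain ⟨ht, hρ⟩ := hQ.1 hq
    obtain ⟨hcard, hrank⟩ := hR hρ
    refine NEC.Network.exists_isLinking F (hrank.trans hcard.symm) ?_
    rw [hcard]
    exact (Nat.add_sub_cancel' (hcut t ht)).le
  choose σ hσ using hlink
  obtain ⟨c, hc⟩ := NEC.Network.exists_code_hasFrontier (F := F) _ _ σ hσ
    (by simpa [Q] using hF)
  have hzero : ∀ t ∈ N.sinks, ∀ ρ ∈ R t, ∀ (x : Fin w → F) (Z : E → F), (∀ e, e ∉ ρ → Z e = 0) →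
      (∀ e, N.head e = t → c.signal x Z e = 0) → x = 0 := by
    intro t ht ρ hρ x Z hZ hsig
    exact (hc ⟨(t, ρ), hQ.2 ⟨ht, hρ⟩⟩).eq_zero_of_signal_eq_zero
      (fun h => N.source_notMem_sinks (h ▸ ht)) hZ hsig
  have hinj : ∀ t ∈ N.sinks, ∀ x : Fin w → F,
      (∀ e, N.head e = t → c.signal x 0 e = 0) → x = 0 := by
    intro t ht x hx
    -- The empty pattern has full rank, so some pattern of size and rank `δ_t` exists.
    obtain ⟨ρ, -, hcard, hrank⟩ := NEC.Network.exists_superset_full_rank (N := N) (F := F)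
      (t := t) (ρ := ∅) (n := N.redundancy w t)
      (Nat.le_antisymm (NEC.Network.rank_le_card (.refl t ∅)) (Nat.zero_le _)) (Nat.zero_le _)
      (Nat.sub_le _ _)
    exact hzero t ht ρ (by simp [R, NEC.Network.fullRankPatterns, hcard, hrank]) x 0
      (fun _ _ => rfl) hx
  refine ⟨c, fun t ht => NEC.Network.LinearCode.finrank_messageSpace (hinj t ht), fun t ht =>
    NEC.Network.LinearCode.minDistance_eq hw (hcut t ht) (hinj t ht) fun ρ hρ => ?_⟩
  rw [Submodule.eq_bot_iff]
  rintro _ ⟨⟨Z, hZ, rfl⟩, x, hx⟩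
  have hx0 : x = 0 := by
    refine hzero t ht ρ hρ x (-Z) (fun e he => by simp [hZ e he]) fun e he => ?_
    have h1 : c.signal 0 Z e = c.signal x 0 e := congrFun hx ⟨e, he⟩
    have h2 := c.signal_add x 0 0 (-Z) e
    have h3 := c.signal_smul (-1) 0 Z e
    simp only [smul_zero, neg_smul, one_smul, add_zero, zero_add] at h2 h3
    rw [h2, h3, h1]
    ring
  rw [hx, hx0]
  ext e
  change c.signal 0 0 e.1 = 0
  simpa using c.signal_smul 0 0 0 e.1
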